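/- **Theorem (Path counting at edge level).** Let $\mathcal G$ be a finite simple undirected graph (no loops) with adjacency matrix $A\in\{0,1\}^{n\times n}$. Let $I$ be the identity matrix and $J$ the $n\times n$ matrix with zeros on the diagonal and ones elsewhere. Let $\odot$ be the entrywise product, $\mathbf 1$ the all-ones column vector and $\mathrm{diag}(v)$ the diagonal matrix with diagonal $v$, and let $(M>0)$ be the $0/1$ matrix that marks the positive entries of $M$. An $l$-path between $i$ and $j$ is a walk from $i$ to $j$ along exactly $l$ edges that visits no node twice. Let $\mathrm{ML}(\mathcal L_3)$ be the set of expressions in one square matrix variable built from matrix product, transpose, the all-ones vector $\mathbf 1$, $\mathrm{diag}$ and $\odot$, where in addition (as in every fragment of the language) sums, multiplication by real scalars and entrywise application of functions $\mathbb R\to\mathbb R$ may be used. Set $$\begin{aligned} X_2 &= A^2\odot J,\\ X_3 &= A^3 \odot J - A(A^2\odot I) - (A^2 \odot I)A + A,\\ X_4 &= A^4 \odot J - (A(A^2\odot I-2 I)A)\odot J - (A^2 \odot I)X_2 - X_2(A^2 \odot I)\\ &\quad - A(A^3\odot I) - (A^3 \odot I)A + 3\,A^2\odot A,\\ X_5 &=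 A^5 \odot J - A(A^2\odot I)(A^2\odot I-I) - (A^2\odot I)A(A^2\odot I) - (A^2\odot I- I)(A^2\odot I)A\\ &\quad -(A(A^2\odot I-I)X_2)\odot J -(X_2(A^2\odot I-I)A)\odot J\\ &\quad -(A^2 \odot I)X_3 - X_3(A^2\odot I- I) -(A^3\odot I)X_2-X_2(A^3\odot I)\\ &\quad -(A(A^3\odot I)A)\odot J -A\odot A^2 + 3\,\bigl(A(A \odot A^2) + (A \odot A^2)A\bigr)\odot J\\ &\quad - A\,\mathrm{diag}((A\odot X_3)\mathbf 1)- \mathrm{diag}((A\odot X_3)\mathbf 1)\,A + 3\,A\odot X_3 + 3\, A\odot A^2\odot\bigl(A^2 - (A^2>0)\bigr). \end{aligned}$$ Then for each $l\in\{2,3,4,5\}$ there is an expression in $\mathrm{ML}(\mathcal L_3)$, the same for all graphs, whose value at $A$ is $X_l$, and for all nodes $i,j$ the entry $(X_l)_{i,j}$ is the number of $l$-paths between $i$ and $j$. -/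

import Mathlib

open scoped Matrix

/-- The two possible sizes of an axis of a value of the language when the input is a square
matrix indexed by a node set: `one` (a single index) and `node` (one index per node). -/
inductive Axis : Type
  | one
  | node

/-- The index type of an axis, for inputs indexed by `V`. -/
abbrev Axis.Idx (V : Type*) : Axis → Type _
  | .one => PUnit
  | .node => V

instance Axis.instFintypeIdx (V : Type*) [Fintype V] : (a : Axis) → Fintype (a.Idx V)
  | .one => inferInstanceAs (Fintype PUnit)
  | .node => inferInstanceAs (Fintype V)

instance Axis.instDecidableEqIdx (V : Type*) [DecidableEq V] : (a : Axis) → DecidableEq (a.Idx V)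
  | .one => inferInstanceAs (DecidableEq PUnit)
  | .node => inferInstanceAs (DecidableEq V)

/-- Expressions of the matrix language MATLANG in one square input matrix.  An element of
`MatLang a b` is an expression whose value has rows indexed by `a` and columns indexed by `b`:
`MatLang .node .node` are the square matrices, `MatLang .node .one` the column vectors,
`MatLang .one .node` the row vectors and `MatLang .one .one` the scalars. -/
inductive MatLang : Axis → Axis → Type
  /-- the input matrix -/
  | input : MatLang .node .node
  /-- addition -/
  | add {a b : Axis} : MatLang a b → MatLang a b → MatLang a b
  /-- usual matrix product -/
  | mul {a b c : Axis} : MatLang a b → MatLang b c → MatLang a c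
  /-- element-wise (Hadamard) product -/
  | hadamard {a b : Axis} : MatLang a b → MatLang a b → MatLang a b
  /-- transpose -/
  | transpose {a b : Axis} : MatLang a b → MatLang b a
  /-- trace -/
  | trace {a : Axis} : MatLang a a → MatLang .one .one
  /-- diagonal matrix of a column vector -/
  | diag {a : Axis} : MatLang a .one → MatLang a a
  /-- column vector of ones with as many rows as the argument -/
  | ones {a b : Axis} : MatLang a b → MatLang a .one
  /-- multiplication by a scalar constant -/
  | scale {a b : Axis} : ℝ → MatLang a b → MatLang a b
  /-- element-wise application of a function -/
  | apply {a b : Axis} : (ℝ → ℝ) → MatLang a b → MatLang a b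

namespace MatLang

/-- The names of the operations of MATLANG. -/
inductive Op : Type
  | add | mul | hadamard | transpose | trace | diag | ones | scale | apply

/-- The value of an expression on the input matrix `A`. -/
noncomputable def eval {V : Type*} [Fintype V] [DecidableEq V] (A : Matrix V V ℝ) :
    {a b : Axis} → MatLang a b → Matrix (a.Idx V) (b.Idx V) ℝ
  | _, _, input => A
  | _, _, add e f => eval A e + eval A f
  | _, _, mul e f => eval A e * eval A f
  | _, _, hadamard e f => eval A e ⊙ eval A f
  | _, _, transpose e => (eval A e)ᵀ
  | _, _, trace e => Matrix.of fun _ _ => (eval A e).trace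
  | _, _, diag e => Matrix.diagonal fun i => eval A e i PUnit.unit
  | _, _, ones _ => Matrix.of fun _ _ => 1
  | _, _, scale c e => c • eval A e
  | _, _, apply f e => (eval A e).map f

/-- The set of operations that occur in an expression. -/
def ops : {a b : Axis} → MatLang a b → Set Op
  | _, _, input => ∅
  | _, _, add e f => insert Op.add (ops e ∪ ops f)
  | _, _, mul e f => insert Op.mul (ops e ∪ ops f)
  | _, _, hadamard e f => insert Op.hadamard (ops e ∪ ops f)
  | _, _, transpose e => insert Op.transpose (ops e)
  | _, _, trace e => insert Op.trace (ops e)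
  | _, _, diag e => insert Op.diag (ops e)
  | _, _, ones e => insert Op.ones (ops e)
  | _, _, scale _ e => insert Op.scale (ops e)
  | _, _, apply _ e => insert Op.apply (ops e)

/-- The fragment of MATLANG that uses only the operations in `L`. -/
def fragment (L : Set Op) (a b : Axis) : Set (MatLang a b) :=
  {e | e.ops ⊆ L}

/-- The operation set `L₃`: product, transpose, vector of ones, `diag`, Hadamard product. -/
def L3 : Set Op := {Op.mul, Op.transpose, Op.ones, Op.diag, Op.hadamard}

/-- The operations (addition, multiplication by scalars, element-wise functions) that are
available in every fragment: they do not change its distinguishing power, and so are not listed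
in the operation set that names it. -/
def freeOps : Set Op := {Op.add, Op.scale, Op.apply}

/-- Square matrix expressions of `ML(L₃)`. -/
def ML3 : Set (MatLang .node .node) := fragment (L3 ∪ freeOps) .node .node

end MatLang

section Formulas

variable {V : Type*} [Fintype V] [DecidableEq V]

/-- The matrix filled with ones except for the diagonal, which is zero. -/
def offDiagOnes (V : Type*) [DecidableEq V] : Matrix V V ℝ :=
  Matrix.of fun i j => if i = j then 0 else 1

/-- The 0/1 matrix `(M > 0)` marking the positive entries of `M`. -/
noncomputable def posPart01 (M : Matrix V V ℝ) : Matrix V V ℝ :=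
  M.map fun x => if 0 < x then 1 else 0

local notation "I" => (1 : Matrix V V ℝ)
local notation "J" => offDiagOnes V

/-- The matrix `X₂`. -/
def pathX2 (A : Matrix V V ℝ) : Matrix V V ℝ :=
  (A ^ 2) ⊙ J

/-- The matrix `X₃`. -/
def pathX3 (A : Matrix V V ℝ) : Matrix V V ℝ :=
  (A ^ 3) ⊙ J - A * ((A ^ 2) ⊙ I) - ((A ^ 2) ⊙ I) * A + A

/-- The matrix `X₄`. -/
noncomputable def pathX4 (A : Matrix V V ℝ) : Matrix V V ℝ :=
  (A ^ 4) ⊙ J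
    - (A * ((A ^ 2) ⊙ I - (2 : ℝ) • I) * A) ⊙ J
    - ((A ^ 2) ⊙ I) * pathX2 A - pathX2 A * ((A ^ 2) ⊙ I)
    - A * ((A ^ 3) ⊙ I) - ((A ^ 3) ⊙ I) * A
    + (3 : ℝ) • ((A ^ 2) ⊙ A)

/-- The matrix `X₅`. -/
noncomputable def pathX5 (A : Matrix V V ℝ) : Matrix V V ℝ :=
  (A ^ 5) ⊙ J
    - A * ((A ^ 2) ⊙ I) * ((A ^ 2) ⊙ I - I)
    - ((A ^ 2) ⊙ I) * A * ((A ^ 2) ⊙ I)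
    - ((A ^ 2) ⊙ I - I) * ((A ^ 2) ⊙ I) * A
    - (A * ((A ^ 2) ⊙ I - I) * pathX2 A) ⊙ J
    - (pathX2 A * ((A ^ 2) ⊙ I - I) * A) ⊙ J
    - ((A ^ 2) ⊙ I) * pathX3 A - pathX3 A * ((A ^ 2) ⊙ I - I)
    - ((A ^ 3) ⊙ I) * pathX2 A - pathX2 A * ((A ^ 3) ⊙ I)
    - (A * ((A ^ 3) ⊙ I) * A) ⊙ J - A ⊙ (A ^ 2)
    + (3 : ℝ) • ((A * (A ⊙ (A ^ 2)) + (A ⊙ (A ^ 2)) * A) ⊙ J)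
    - A * Matrix.diagonal ((A ⊙ pathX3 A) *ᵥ 1)
    - Matrix.diagonal ((A ⊙ pathX3 A) *ᵥ 1) * A
    + (3 : ℝ) • (A ⊙ pathX3 A)
    + (3 : ℝ) • (A ⊙ (A ^ 2) ⊙ (A ^ 2 - posPart01 (A ^ 2)))

end Formulas

/-- The number of `l`-paths between `i` and `j`: walks from `i` to `j` along exactly `l` edges that
visit no node twice. -/
noncomputable def numPaths {V : Type*} (G : SimpleGraph V) (l : ℕ) (i j : V) : ℕ :=
  {p : G.Walk i j | p.IsPath ∧ p.length = l}.ncard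

/-! Membership in ML(L₃) is bookkeeping: I = diag(1), J = 11ᵀ - I, and (M > 0) is an entrywise
function, so each formula can be copied as an expression.

The counting is inclusion-exclusion. On the diagonal both sides vanish. For i ≠ j, an l-path is a
tuple of inner nodes, so its count is a sum of products of adjacency entries and masks
`offDiagOnes`, one per non-consecutive pair other than the endpoints; consecutive nodes differ
because there are no loops. Removing a mask subtracts the term where its two nodes coincide. What
remains are sums over walks, identified with entries of powers of A after reducing squares by
`IsAdj.idem`.

For l = 5 and a path i, a, b, c, d, j, first fix b and c. Then a and d are independent except for a
≠ d, which gives the closed form `middleCount` (`IsAdj.middleCount_eq_sum`). Excluding i and j as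
values of b and c leaves the full sum of `middleCount`, four boundary sums and four corner values
(`sum_sum_masked`). These add up to the entry of X₅ (`IsAdj.pathX5_eq_sum`). -/

namespace MatLang

/-- The identity matrix. -/
def ident : MatLang .node .node := diag (ones input)

/-- Subtraction. -/
def sub {a b : Axis} (e f : MatLang a b) : MatLang a b := add e (scale (-1) f)

/-- The matrix of ones with zeros on the diagonal. -/
def offDiag : MatLang .node .node := sub (mul (ones input) (transpose (ones input))) ident

/-- Powers of the input matrix. -/
def inputPow : ℕ → MatLang .node .node
  | 0 => ident
  | n + 1 => mul (inputPow n) input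

/-- The restriction of a square matrix to its diagonal. -/
def diagPart (e : MatLang .node .node) : MatLang .node .node := hadamard e ident

/-- The restriction of a square matrix to its off-diagonal entries. -/
def offDiagPart (e : MatLang .node .node) : MatLang .node .node := hadamard e offDiag

/-- The 0/1 matrix marking the positive entries. -/
noncomputable def marks (e : MatLang .node .node) : MatLang .node .node :=
  apply (fun x => if 0 < x then 1 else 0) e

/-- The diagonal matrix of the row sums. -/
def rowSums (e : MatLang .node .node) : MatLang .node .node := diag (mul e (ones input))

/-! ### Closure of ML(L₃) under the derived operations -/

section Membership

variable {e f : MatLang .node .node}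

lemma input_mem : input ∈ ML3 := by simp [ML3, fragment, ops]

lemma add_mem (he : e ∈ ML3) (hf : f ∈ ML3) : add e f ∈ ML3 := by
  simp_all [ML3, fragment, ops, Set.insert_subset_iff, L3, freeOps]

lemma mul_mem (he : e ∈ ML3) (hf : f ∈ ML3) : mul e f ∈ ML3 := by
  simp_all [ML3, fragment, ops, Set.insert_subset_iff, L3, freeOps]

lemma hadamard_mem (he : e ∈ ML3) (hf : f ∈ ML3) : hadamard e f ∈ ML3 := by
  simp_all [ML3, fragment, ops, Set.insert_subset_iff, L3, freeOps]

lemma scale_mem (c : ℝ) (he : e ∈ ML3) : scale c e ∈ ML3 := by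
  simp_all [ML3, fragment, ops, Set.insert_subset_iff, L3, freeOps]

lemma sub_mem (he : e ∈ ML3) (hf : f ∈ ML3) : sub e f ∈ ML3 :=
  add_mem he (scale_mem _ hf)

lemma marks_mem (he : e ∈ ML3) : marks e ∈ ML3 := by
  simp_all [ML3, fragment, ops, Set.insert_subset_iff, L3, freeOps, marks]

lemma rowSums_mem (he : e ∈ ML3) : rowSums e ∈ ML3 := by
  simp_all [ML3, fragment, ops, Set.insert_subset_iff, L3, freeOps, rowSums]

lemma ident_mem : ident ∈ ML3 := by
  simp [ML3, fragment, ops, Set.insert_subset_iff, L3, freeOps, ident]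

lemma offDiag_mem : offDiag ∈ ML3 := by
  simp [ML3, fragment, ops, Set.insert_subset_iff, L3, freeOps, ident, offDiag, sub]

lemma diagPart_mem (he : e ∈ ML3) : diagPart e ∈ ML3 := hadamard_mem he ident_mem

lemma offDiagPart_mem (he : e ∈ ML3) : offDiagPart e ∈ ML3 := hadamard_mem he offDiag_mem

lemma inputPow_mem (n : ℕ) : inputPow n ∈ ML3 := by
  induction n with
  | zero => exact ident_mem
  | succ n ih => exact mul_mem ih input_mem

end Membership

/-! ### Values of the derived operations -/

section Evaluation

variable {V : Type*} [Fintype V] [DecidableEq V]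

/-- The value of a square matrix expression, as a matrix indexed by the node set. -/
noncomputable def value (A : Matrix V V ℝ) (e : MatLang .node .node) : Matrix V V ℝ := eval A e

variable (A : Matrix V V ℝ) (e f : MatLang .node .node)

lemma value_input : value A input = A := rfl

lemma value_add : value A (add e f) = value A e + value A f := rfl

lemma value_mul : value A (mul e f) = value A e * value A f := rfl

lemma value_hadamard : value A (hadamard e f) = value A e ⊙ value A f := rfl

lemma value_scale (c : ℝ) : value A (scale c e) = c • value A e := rfl

lemma value_sub : value A (sub e f) = value A e - value A f := by
  rw [sub, value_add, value_scale, neg_one_smul, sub_eq_add_neg]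

lemma value_marks : value A (marks e) = posPart01 (value A e) := rfl

lemma value_ident : value A ident = 1 := Matrix.diagonal_one

lemma value_rowSums : value A (rowSums e) = Matrix.diagonal (value A e *ᵥ 1) := by
  rfl

lemma value_offDiag : value A offDiag = offDiagOnes V := by
  have h : value A (mul (ones input) (transpose (ones input))) = Matrix.of fun _ _ => 1 := by
    ext i j
    change ∑ _ : PUnit, (1 : ℝ) * 1 = 1
    simp
  rw [offDiag, value_sub, value_ident, h]
  ext i j
  by_cases hij : i = j <;> simp [offDiagOnes, hij]

lemma value_inputPow (n : ℕ) : value A (inputPow n) = A ^ n := by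
  induction n with
  | zero => rw [inputPow, value_ident, pow_zero]
  | succ n ih => rw [inputPow, value_mul, ih, value_input, pow_succ]

lemma value_diagPart : value A (diagPart e) = value A e ⊙ 1 := by
  rw [diagPart, value_hadamard, value_ident]

lemma value_offDiagPart : value A (offDiagPart e) = value A e ⊙ offDiagOnes V := by
  rw [offDiagPart, value_hadamard, value_offDiag]

end Evaluation

/-! ### Expressions for the four formulas -/

/-- An expression for `pathX2`. -/
def exprX2 : MatLang .node .node := offDiagPart (inputPow 2)

/-- An expression for `pathX3`. -/
def exprX3 : MatLang .node .node :=
  add (sub (sub (offDiagPart (inputPow 3)) (mul input (diagPart (inputPow 2))))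
    (mul (diagPart (inputPow 2)) input)) input

/-- An expression for `pathX4`. -/
noncomputable def exprX4 : MatLang .node .node :=
  add (sub (sub (sub (sub (sub (offDiagPart (inputPow 4))
    (offDiagPart (mul (mul input (sub (diagPart (inputPow 2)) (scale 2 ident))) input)))
    (mul (diagPart (inputPow 2)) exprX2)) (mul exprX2 (diagPart (inputPow 2))))
    (mul input (diagPart (inputPow 3)))) (mul (diagPart (inputPow 3)) input))
    (scale 3 (hadamard (inputPow 2) input))

/-- An expression for `pathX5`. -/
noncomputable def exprX5 : MatLang .node .node :=
  let D := diagPart (inputPow 2)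
  let T := diagPart (inputPow 3)
  let S := rowSums (hadamard input exprX3)
  let W := hadamard input (inputPow 2)
  let e₁ := sub (sub (sub (offDiagPart (inputPow 5)) (mul (mul input D) (sub D ident)))
    (mul (mul D input) D)) (mul (mul (sub D ident) D) input)
  let e₂ := sub (sub e₁ (offDiagPart (mul (mul input (sub D ident)) exprX2)))
    (offDiagPart (mul (mul exprX2 (sub D ident)) input))
  let e₃ := sub (sub (sub (sub e₂ (mul D exprX3)) (mul exprX3 (sub D ident))) (mul T exprX2))
    (mul exprX2 T)
  let e₄ := add (sub (sub e₃ (offDiagPart (mul (mul input T) input))) W)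
    (scale 3 (offDiagPart (add (mul input W) (mul W input))))
  add (add (sub (sub e₄ (mul input S)) (mul S input)) (scale 3 (hadamard input exprX3)))
    (scale 3 (hadamard W (sub (inputPow 2) (marks (inputPow 2)))))

lemma exprX2_mem : exprX2 ∈ ML3 := offDiagPart_mem (inputPow_mem 2)

lemma exprX3_mem : exprX3 ∈ ML3 := by
  unfold exprX3
  -- Reducible transparency keeps derived operations such as `sub` and `offDiagPart` folded, so each
  -- meets its own closure lemma.
  repeat' first
    | with_reducible exact exprX2_mem
    | with_reducible exact inputPow_mem _
    | with_reducible exact input_mem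
    | with_reducible exact ident_mem
    | with_reducible apply add_mem
    | with_reducible apply sub_mem
    | with_reducible apply mul_mem
    | with_reducible apply hadamard_mem
    | with_reducible apply scale_mem
    | with_reducible apply diagPart_mem
    | with_reducible apply offDiagPart_mem

lemma exprX4_mem : exprX4 ∈ ML3 := by
  unfold exprX4
  repeat' first
    | with_reducible exact exprX2_mem
    | with_reducible exact inputPow_mem _
    | with_reducible exact input_mem
    | with_reducible exact ident_mem
    | with_reducible apply add_mem
    | with_reducible apply sub_mem
    | with_reducible apply mul_mem
    | with_reducible apply hadamard_mem
    | with_reducible apply scale_mem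
    | with_reducible apply diagPart_mem
    | with_reducible apply offDiagPart_mem

lemma exprX5_mem : exprX5 ∈ ML3 := by
  unfold exprX5
  dsimp only
  repeat' first
    | with_reducible exact exprX2_mem
    | with_reducible exact exprX3_mem
    | with_reducible exact inputPow_mem _
    | with_reducible exact input_mem
    | with_reducible exact ident_mem
    | with_reducible apply add_mem
    | with_reducible apply sub_mem
    | with_reducible apply mul_mem
    | with_reducible apply hadamard_mem
    | with_reducible apply scale_mem
    | with_reducible apply diagPart_mem
    | with_reducible apply offDiagPart_mem
    | with_reducible apply rowSums_mem
    | with_reducible apply marks_mem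

section Evaluation

variable {V : Type*} [Fintype V] [DecidableEq V] (A : Matrix V V ℝ)

lemma value_exprX2 : value A exprX2 = pathX2 A := by
  simp only [exprX2, value_offDiagPart, value_inputPow, pathX2]

lemma value_exprX3 : value A exprX3 = pathX3 A := by
  simp only [exprX3, value_add, value_sub, value_mul, value_offDiagPart, value_diagPart,
    value_inputPow, value_input, pathX3]

lemma value_exprX4 : value A exprX4 = pathX4 A := by
  simp only [exprX4, value_add, value_sub, value_mul, value_offDiagPart, value_diagPart,
    value_inputPow, value_input, value_scale, value_hadamard, value_ident, value_exprX2, pathX4]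

lemma value_exprX5 : value A exprX5 = pathX5 A := by
  simp only [exprX5, value_add, value_sub, value_mul, value_offDiagPart, value_diagPart,
    value_inputPow, value_input, value_scale, value_hadamard, value_ident, value_exprX2,
    value_exprX3, value_rowSums, value_marks, pathX5]

end Evaluation

end MatLang

/-! ### Path counts as masked sums over inner nodes -/

section Counting

open SimpleGraph

variable {V : Type*} (G : SimpleGraph V) {i j : V}

lemma numPaths_self (l : ℕ) (i : V) : numPaths G (l + 1) i i = 0 := by
  refine (congrArg Set.ncard (Set.eq_empty_of_forall_notMem ?_)).trans (Set.ncard_empty _)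
  rintro p ⟨hp, hl⟩
  have := Walk.length_eq_zero_iff.2 (Walk.isPath_iff_nil.1 hp)
  omega

lemma ncard_path_two (hij : i ≠ j) : numPaths G 2 i j =
    {a : V | G.Adj i a ∧ G.Adj a j}.ncard := by
  refine Set.ncard_congr (fun p _ => p.getVert 1) ?_ ?_ ?_
  · rintro (_ | ⟨h₁, _ | ⟨h₂, _ | ⟨h₃, p⟩⟩⟩) ⟨hp, hl⟩ <;> simp at hl
    exact ⟨h₁, by simpa using h₂⟩
  · rintro (_ | ⟨h₁, _ | ⟨h₂, _ | ⟨h₃, p⟩⟩⟩) (_ | ⟨g₁, _ | ⟨g₂, _ | ⟨g₃, q⟩⟩⟩)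
      ⟨hp, hl⟩ ⟨hq, hk⟩ h <;> simp at hl hk
    simp at h
    subst h
    rfl
  · rintro a ⟨h₁, h₂⟩
    refine ⟨.cons h₁ (.cons h₂ .nil), ?_, by simp⟩
    simp
    have := h₁.ne; have := h₂.ne
    grind

/-- A path is determined by its inner nodes. Here and for lengths 4 and 5 the tuple lists the middle
nodes first, so that they become the outer summation variables. -/
lemma ncard_path_three (hij : i ≠ j) : numPaths G 3 i j =
    {t : V × V | (G.Adj i t.2 ∧ G.Adj t.2 t.1 ∧ G.Adj t.1 j) ∧ t.2 ≠ j ∧ t.1 ≠ i}.ncard := by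
  refine Set.ncard_congr (fun p _ => (p.getVert 2, p.getVert 1)) ?_ ?_ ?_
  · rintro (_ | ⟨h₁, _ | ⟨h₂, _ | ⟨h₃, _ | ⟨h₄, p⟩⟩⟩⟩) ⟨hp, hl⟩ <;> simp at hl
    simp at hp
    simp
    grind
  · rintro (_ | ⟨h₁, _ | ⟨h₂, _ | ⟨h₃, _ | ⟨h₄, p⟩⟩⟩⟩)
      (_ | ⟨g₁, _ | ⟨g₂, _ | ⟨g₃, _ | ⟨g₄, q⟩⟩⟩⟩) ⟨hp, hl⟩ ⟨hq, hk⟩ h <;> simp at hl hk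
    simp at h
    obtain ⟨rfl, rfl⟩ := h
    rfl
  · rintro ⟨b, a⟩ ht
    obtain ⟨⟨h₁, h₂, h₃⟩, h⟩ := ht
    refine ⟨.cons h₁ (.cons h₂ (.cons h₃ .nil)), ?_, by simp⟩
    simp
    have := h₁.ne; have := h₂.ne; have := h₃.ne
    grind

lemma ncard_path_four (hij : i ≠ j) : numPaths G 4 i j =
    {t : V × V × V | (G.Adj i t.2.1 ∧ G.Adj t.2.1 t.1 ∧ G.Adj t.1 t.2.2 ∧ G.Adj t.2.2 j) ∧
      t.1 ≠ i ∧ t.1 ≠ j ∧ t.2.1 ≠ j ∧ t.2.2 ≠ i ∧ t.2.2 ≠ t.2.1}.ncard := by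
  refine Set.ncard_congr (fun p _ => (p.getVert 2, p.getVert 1, p.getVert 3)) ?_ ?_ ?_
  · rintro (_ | ⟨h₁, _ | ⟨h₂, _ | ⟨h₃, _ | ⟨h₄, _ | ⟨h₅, p⟩⟩⟩⟩⟩) ⟨hp, hl⟩ <;> simp at hl
    simp at hp
    simp
    grind
  · rintro (_ | ⟨h₁, _ | ⟨h₂, _ | ⟨h₃, _ | ⟨h₄, _ | ⟨h₅, p⟩⟩⟩⟩⟩)
      (_ | ⟨g₁, _ | ⟨g₂, _ | ⟨g₃, _ | ⟨g₄, _ | ⟨g₅, q⟩⟩⟩⟩⟩) ⟨hp, hl⟩ ⟨hq, hk⟩ h <;> simp at hl hk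
    simp at h
    obtain ⟨rfl, rfl, rfl⟩ := h
    rfl
  · rintro ⟨b, a, c⟩ ht
    obtain ⟨⟨h₁, h₂, h₃, h₄⟩, h⟩ := ht
    refine ⟨.cons h₁ (.cons h₂ (.cons h₃ (.cons h₄ .nil))), ?_, by simp⟩
    simp
    have := h₁.ne; have := h₂.ne; have := h₃.ne; have := h₄.ne
    grind

lemma ncard_path_five (hij : i ≠ j) : numPaths G 5 i j =
    {t : V × V × V × V | (G.Adj i t.2.2.1 ∧ G.Adj t.2.2.1 t.1 ∧ G.Adj t.1 t.2.1 ∧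
      G.Adj t.2.1 t.2.2.2 ∧ G.Adj t.2.2.2 j) ∧ t.1 ≠ i ∧ t.1 ≠ j ∧ t.2.1 ≠ i ∧ t.2.1 ≠ j ∧
      t.2.2.1 ≠ t.2.1 ∧ t.2.2.1 ≠ j ∧ t.2.2.2 ≠ i ∧ t.2.2.2 ≠ t.1 ∧ t.2.2.2 ≠ t.2.2.1}.ncard := by
  refine Set.ncard_congr
    (fun p _ => (p.getVert 2, p.getVert 3, p.getVert 1, p.getVert 4)) ?_ ?_ ?_
  · rintro (_ | ⟨h₁, _ | ⟨h₂, _ | ⟨h₃, _ | ⟨h₄, _ | ⟨h₅, _ | ⟨h₆, p⟩⟩⟩⟩⟩⟩) ⟨hp, hl⟩ <;>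
      simp at hl
    simp at hp
    simp
    grind
  · rintro (_ | ⟨h₁, _ | ⟨h₂, _ | ⟨h₃, _ | ⟨h₄, _ | ⟨h₅, _ | ⟨h₆, p⟩⟩⟩⟩⟩⟩)
      (_ | ⟨g₁, _ | ⟨g₂, _ | ⟨g₃, _ | ⟨g₄, _ | ⟨g₅, _ | ⟨g₆, q⟩⟩⟩⟩⟩⟩) ⟨hp, hl⟩ ⟨hq, hk⟩ h <;>
      simp at hl hk
    simp at h
    obtain ⟨rfl, rfl, rfl, rfl⟩ := h
    rfl
  · rintro ⟨b, c, a, d⟩ ht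
    obtain ⟨⟨h₁, h₂, h₃, h₄, h₅⟩, h⟩ := ht
    refine ⟨.cons h₁ (.cons h₂ (.cons h₃ (.cons h₄ (.cons h₅ .nil)))), ?_, by simp⟩
    simp
    have := h₁.ne; have := h₂.ne; have := h₃.ne; have := h₄.ne; have := h₅.ne
    grind

lemma ncard_setOf_eq_sum {α : Type*} [Fintype α] (p : α → Prop) [DecidablePred p] :
    ({t | p t}.ncard : ℝ) = ∑ t, if p t then 1 else 0 := by
  rw [Finset.sum_boole, ← Set.ncard_coe_finset]
  congr 2
  ext t
  simp

lemma ite_ne_eq_offDiagOnes [DecidableEq V] (x y : V) : (if x ≠ y then (1 : ℝ) else 0) = offDiagOnes V x y := by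
  simp [offDiagOnes]

lemma ite_and_eq_mul (p q : Prop) [Decidable p] [Decidable q] :
    (if p ∧ q then (1 : ℝ) else 0) = (if p then 1 else 0) * (if q then 1 else 0) := by
  by_cases hp : p <;> simp [hp]

variable [Fintype V] [DecidableRel G.Adj]

lemma numPaths_two (hij : i ≠ j) : (numPaths G 2 i j : ℝ) =
    ∑ a, G.adjMatrix ℝ i a * G.adjMatrix ℝ a j := by
  rw [ncard_path_two G hij, ncard_setOf_eq_sum]
  simp only [ite_and_eq_mul, ← adjMatrix_apply]

variable [DecidableEq V]

lemma numPaths_three (hij : i ≠ j) : (numPaths G 3 i j : ℝ) =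
    ∑ b, G.adjMatrix ℝ b j * (∑ a, G.adjMatrix ℝ i a * G.adjMatrix ℝ a b * offDiagOnes V a j) *
      offDiagOnes V b i := by
  rw [ncard_path_three G hij, ncard_setOf_eq_sum, Fintype.sum_prod_type]
  simp only [ite_and_eq_mul, ite_ne_eq_offDiagOnes, ← adjMatrix_apply, Finset.mul_sum, Finset.sum_mul]
  exact Finset.sum_congr rfl fun b _ => Finset.sum_congr rfl fun a _ => by ring

lemma numPaths_four (hij : i ≠ j) : (numPaths G 4 i j : ℝ) =
    ∑ b, (∑ a, ∑ c, (G.adjMatrix ℝ i a * G.adjMatrix ℝ a b * offDiagOnes V a j) *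
      (G.adjMatrix ℝ b c * G.adjMatrix ℝ c j * offDiagOnes V c i) * offDiagOnes V c a) *
      offDiagOnes V b i * offDiagOnes V b j := by
  rw [ncard_path_four G hij, ncard_setOf_eq_sum]
  simp only [Fintype.sum_prod_type]
  simp only [ite_and_eq_mul, ite_ne_eq_offDiagOnes, ← adjMatrix_apply, Finset.sum_mul]
  exact Finset.sum_congr rfl fun b _ => Finset.sum_congr rfl fun a _ =>
    Finset.sum_congr rfl fun c _ => by ring

lemma numPaths_five (hij : i ≠ j) : (numPaths G 5 i j : ℝ) =
    ∑ b, ∑ c, G.adjMatrix ℝ b c *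
      (∑ a, ∑ d, (G.adjMatrix ℝ i a * G.adjMatrix ℝ a b * offDiagOnes V a c * offDiagOnes V a j) *
        (G.adjMatrix ℝ c d * G.adjMatrix ℝ d j * offDiagOnes V d i * offDiagOnes V d b) *
        offDiagOnes V d a) * offDiagOnes V c i * offDiagOnes V c j *
      (offDiagOnes V b i * offDiagOnes V b j) := by
  rw [ncard_path_five G hij, ncard_setOf_eq_sum]
  simp only [Fintype.sum_prod_type]
  simp only [ite_and_eq_mul, ite_ne_eq_offDiagOnes, ← adjMatrix_apply, Finset.mul_sum, Finset.sum_mul]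
  exact Finset.sum_congr rfl fun b _ => Finset.sum_congr rfl fun c _ =>
    Finset.sum_congr rfl fun a _ => Finset.sum_congr rfl fun d _ => by ring

end Counting

/-! ### Inclusion-exclusion for masks -/

section Masks

lemma offDiagOnes_of_ne {V : Type*} [DecidableEq V] {x y : V} (h : x ≠ y) :
    offDiagOnes V x y = 1 := by
  simp [offDiagOnes, h]

lemma offDiagOnes_self {V : Type*} [DecidableEq V] (x : V) : offDiagOnes V x x = 0 := by
  simp [offDiagOnes]

variable {V : Type*} [Fintype V] [DecidableEq V]

lemma sum_mul_offDiagOnes (h : V → ℝ) (x : V) :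
    ∑ a, h a * offDiagOnes V a x = ∑ a, h a - h x := by
  have : ∀ a, h a * offDiagOnes V a x = h a - if a = x then h a else 0 := fun a => by
    by_cases e : a = x <;> simp [offDiagOnes, e]
  simp [this]

lemma sum_mul_offDiagOnes_mul_offDiagOnes (h : V → ℝ) {x y : V} (hxy : x ≠ y) :
    ∑ a, h a * offDiagOnes V a x * offDiagOnes V a y = ∑ a, h a - h x - h y := by
  rw [sum_mul_offDiagOnes (fun a => h a * offDiagOnes V a x), sum_mul_offDiagOnes]
  simp [offDiagOnes, hxy.symm]

/-- Two independent choices, minus the coincidences. -/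
lemma sum_sum_mul_offDiagOnes (f g : V → ℝ) :
    ∑ a, ∑ d, f a * g d * offDiagOnes V d a = (∑ a, f a) * (∑ d, g d) - ∑ a, f a * g a := by
  simp only [sum_mul_offDiagOnes, Finset.sum_sub_distrib, Finset.sum_mul_sum]

lemma sum_sum_masked (F : V → V → ℝ) {i j : V} (hij : i ≠ j) :
    ∑ b, ∑ c, F b c * offDiagOnes V c i * offDiagOnes V c j *
      (offDiagOnes V b i * offDiagOnes V b j) =
    ∑ b, ∑ c, F b c - ∑ c, F i c - ∑ c, F j c - ∑ b, F b i - ∑ b, F b j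
      + F i i + F i j + F j i + F j j := by
  simp only [← Finset.sum_mul, sum_mul_offDiagOnes_mul_offDiagOnes _ hij, ← mul_assoc]
  simp only [Finset.sum_sub_distrib]
  ring

end Masks

/-! ### Entries of the matrices X₂ to X₅ -/

section Entries

/-- Symmetric matrices with zero diagonal and idempotent entries: the adjacency matrices. -/
structure IsAdj {V : Type*} (A : Matrix V V ℝ) : Prop where
  symm : ∀ x y, A x y = A y x
  diag : ∀ x, A x x = 0
  idem : ∀ x y, A x y * A x y = A x y

lemma IsAdj.mul_offDiagOnes {V : Type*} [DecidableEq V] {A : Matrix V V ℝ} (hA : IsAdj A) (x y : V) :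
    A x y * offDiagOnes V x y = A x y := by
  rcases eq_or_ne x y with rfl | h
  · simp [hA.diag]
  · simp [offDiagOnes_of_ne h]

variable {V : Type*} [Fintype V] [DecidableEq V] {A : Matrix V V ℝ}

lemma pow_two_apply (x y : V) : (A ^ 2) x y = ∑ a, A x a * A a y := by
  rw [pow_two, Matrix.mul_apply]

lemma pow_three_apply (x y : V) : (A ^ 3) x y = ∑ a, A x a * (A ^ 2) a y := by
  rw [pow_succ', Matrix.mul_apply]

lemma pow_three_apply' (x y : V) : (A ^ 3) x y = ∑ a, (A ^ 2) x a * A a y := by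
  rw [pow_succ, Matrix.mul_apply]

lemma pow_four_apply (x y : V) : (A ^ 4) x y = ∑ a, A x a * (A ^ 3) a y := by
  rw [pow_succ', Matrix.mul_apply]

lemma pow_four_apply' (x y : V) : (A ^ 4) x y = ∑ a, (A ^ 2) x a * (A ^ 2) a y := by
  rw [← Matrix.mul_apply, ← pow_add]

lemma pow_five_apply (x y : V) :
    (A ^ 5) x y = ∑ b, (A ^ 2) x b * (A ^ 3) b y := by
  rw [← Matrix.mul_apply, ← pow_add]

lemma IsAdj.pow_symm (hA : IsAdj A) (k : ℕ) (x y : V) : (A ^ k) x y = (A ^ k) y x := by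
  have h : Aᵀ = A := by ext x y; exact hA.symm y x
  have := congrFun (congrFun (Matrix.transpose_pow A k) y) x
  rwa [h] at this

lemma IsAdj.pow_two_nonneg (hA : IsAdj A) (x y : V) : 0 ≤ (A ^ 2) x y := by
  rw [pow_two_apply]
  refine Finset.sum_nonneg fun a _ => mul_nonneg ?_ ?_
  · rw [← hA.idem]; exact mul_self_nonneg _
  · rw [← hA.idem]; exact mul_self_nonneg _

/-- The entries of A² are nonnegative, so an unmarked entry is already zero. This removes the only
non-polynomial term of X₅. -/
lemma IsAdj.pow_two_mul_posPart01 (hA : IsAdj A) (x y : V) :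
    (A ^ 2) x y * posPart01 (A ^ 2) x y = (A ^ 2) x y := by
  have h := hA.pow_two_nonneg x y
  simp only [posPart01, Matrix.map_apply]
  split_ifs with h'
  · simp
  · simp [le_antisymm (not_lt.1 h') h]

lemma pathX2_apply (x y : V) : pathX2 A x y = (A ^ 2) x y * offDiagOnes V x y := rfl

lemma pathX3_apply (x y : V) : pathX3 A x y =
    (A ^ 3) x y * offDiagOnes V x y - A x y * (A ^ 2) y y - (A ^ 2) x x * A x y + A x y := by
  simp [pathX3, Matrix.hadamard_one]

lemma IsAdj.mul_pathX3 (hA : IsAdj A) (x y : V) : A x y * pathX3 A x y =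
    A x y * (A ^ 3) x y - A x y * (A ^ 2) y y - (A ^ 2) x x * A x y + A x y := by
  rw [pathX3_apply]
  linear_combination (A ^ 3) x y * hA.mul_offDiagOnes x y +
    (1 - (A ^ 2) y y - (A ^ 2) x x) * hA.idem x y

lemma IsAdj.pow_two_diag (hA : IsAdj A) (x : V) : (A ^ 2) x x = ∑ a, A x a := by
  rw [pow_two_apply]
  exact Finset.sum_congr rfl fun a _ => by rw [hA.symm a x, hA.idem]

/-- Closing a 3-path by an edge gives an oriented 4-cycle through x; the right side is the closed
4-walks corrected for backtracking. -/
lemma IsAdj.rowSum_mul_pathX3 (hA : IsAdj A) (x : V) : ((A ⊙ pathX3 A) *ᵥ 1) x =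
    (A ^ 4) x x - ∑ a, A x a * (A ^ 2) a a - (A ^ 2) x x * (A ^ 2) x x + (A ^ 2) x x := by
  have h : ∑ a, A x a * (A ^ 3) x a = (A ^ 4) x x := by
    rw [pow_four_apply]
    exact Finset.sum_congr rfl fun a _ => by rw [hA.pow_symm 3 a x]
  simp only [Matrix.mulVec, dotProduct, Pi.one_apply, mul_one, Matrix.hadamard_apply, hA.mul_pathX3,
    Finset.sum_add_distrib, Finset.sum_sub_distrib, ← Finset.mul_sum, ← hA.pow_two_diag, h]

lemma sum_mul_mul_pathX2 (f : V → ℝ) (x : V) :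
    ∑ b, f b * pathX2 A b x = ∑ b, f b * (A ^ 2) b x - f x * (A ^ 2) x x := by
  simp only [pathX2_apply, ← mul_assoc]
  exact sum_mul_offDiagOnes (fun b => f b * (A ^ 2) b x) x

lemma IsAdj.pathX2_symm (hA : IsAdj A) (x y : V) : pathX2 A x y = pathX2 A y x := by
  simp only [pathX2_apply, hA.pow_symm 2 x y, offDiagOnes, Matrix.of_apply, eq_comm]

lemma pathX4_apply_of_ne {i j : V} (hij : i ≠ j) : pathX4 A i j =
    (A ^ 4) i j - (∑ a, A i a * (A ^ 2) a a * A a j - 2 * (A ^ 2) i j)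
      - (A ^ 2) i i * (A ^ 2) i j - (A ^ 2) i j * (A ^ 2) j j
      - A i j * (A ^ 3) j j - (A ^ 3) i i * A i j + 3 * ((A ^ 2) i j * A i j) := by
  have h : (A * (Matrix.diagonal (A ^ 2).diag - (2 : ℝ) • (1 : Matrix V V ℝ)) * A) i j =
      ∑ a, A i a * (A ^ 2) a a * A a j - 2 * (A ^ 2) i j := by
    rw [Matrix.smul_one_eq_diagonal, Matrix.diagonal_sub, Matrix.mul_apply]
    simp only [Matrix.mul_diagonal, Matrix.diag_apply, pow_two_apply i j, Finset.mul_sum,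
      ← Finset.sum_sub_distrib]
    exact Finset.sum_congr rfl fun a _ => by ring
  simp only [pathX4, Matrix.hadamard_one, Matrix.sub_apply, Matrix.add_apply, Matrix.smul_apply,
    Matrix.mul_diagonal, Matrix.diagonal_mul, Matrix.hadamard_apply, h, Matrix.diag_apply,
    offDiagOnes_of_ne hij, pathX2_apply, smul_eq_mul, mul_one]

lemma IsAdj.pathX5_apply_of_ne (hA : IsAdj A) {i j : V} (hij : i ≠ j) : pathX5 A i j =
    (A ^ 5) i j - A i j * (A ^ 2) j j * ((A ^ 2) j j - 1) - (A ^ 2) i i * A i j * (A ^ 2) j j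
      - ((A ^ 2) i i - 1) * (A ^ 2) i i * A i j
      - (∑ a, A i a * (A ^ 2) a a * (A ^ 2) a j - (A ^ 3) i j
        - A i j * ((A ^ 2) j j - 1) * (A ^ 2) j j)
      - (∑ a, (A ^ 2) i a * (A ^ 2) a a * A a j - (A ^ 3) i j
        - A i j * ((A ^ 2) i i - 1) * (A ^ 2) i i)
      - ((A ^ 2) i i + (A ^ 2) j j - 1) *
        ((A ^ 3) i j - A i j * (A ^ 2) j j - (A ^ 2) i i * A i j + A i j)
      - (A ^ 3) i i * (A ^ 2) i j - (A ^ 2) i j * (A ^ 3) j j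
      - ∑ a, A i a * (A ^ 3) a a * A a j
      - A i j * (A ^ 2) i j
      + 3 * (∑ a, A i a * A a j * (A ^ 2) a j + ∑ a, A i a * A a j * (A ^ 2) i a)
      - A i j * ((A ^ 4) j j - ∑ a, A j a * (A ^ 2) a a - (A ^ 2) j j * (A ^ 2) j j + (A ^ 2) j j)
      - ((A ^ 4) i i - ∑ a, A i a * (A ^ 2) a a - (A ^ 2) i i * (A ^ 2) i i + (A ^ 2) i i) * A i j
      + 3 * (A i j * (A ^ 3) i j - A i j * (A ^ 2) j j - (A ^ 2) i i * A i j + A i j)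
      + 3 * (A i j * ((A ^ 2) i j * (A ^ 2) i j - (A ^ 2) i j)) := by
  have hD : Matrix.diagonal (A ^ 2).diag - (1 : Matrix V V ℝ) =
      Matrix.diagonal (fun x => (A ^ 2) x x - 1) := by
    rw [← Matrix.diagonal_one, Matrix.diagonal_sub]; rfl
  have hp : A i j * (A ^ 2) i j * ((A ^ 2) i j - posPart01 (A ^ 2) i j) =
      A i j * ((A ^ 2) i j * (A ^ 2) i j - (A ^ 2) i j) := by
    linear_combination - A i j * hA.pow_two_mul_posPart01 i j
  -- X₂ lacks the diagonal of A². The resulting correction, here at a = j and in `h₂` at a = i,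
  -- cancels the terms A D (D - I) and (D - I) D A of X₅, where D = A² ⊙ I.
  have h₁ : (A * Matrix.diagonal (fun x => (A ^ 2) x x - 1) * pathX2 A) i j =
      ∑ a, A i a * (A ^ 2) a a * (A ^ 2) a j - (A ^ 3) i j
        - A i j * ((A ^ 2) j j - 1) * (A ^ 2) j j := by
    rw [Matrix.mul_apply]
    simp only [Matrix.mul_diagonal]
    rw [sum_mul_mul_pathX2 (fun a => A i a * ((A ^ 2) a a - 1)), pow_three_apply,
      ← Finset.sum_sub_distrib]
    congr 1
    exact Finset.sum_congr rfl fun a _ => by ring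
  have h₂ : (pathX2 A * Matrix.diagonal (fun x => (A ^ 2) x x - 1) * A) i j =
      ∑ a, (A ^ 2) i a * (A ^ 2) a a * A a j - (A ^ 3) i j
        - A i j * ((A ^ 2) i i - 1) * (A ^ 2) i i := by
    rw [Matrix.mul_apply]
    simp only [Matrix.mul_diagonal]
    have := sum_mul_mul_pathX2 (A := A) (fun a => A a j * ((A ^ 2) a a - 1)) i
    refine (Finset.sum_congr rfl fun a _ => ?_).trans (this.trans ?_)
    · rw [hA.pathX2_symm i a]; ring
    · rw [pow_three_apply', ← Finset.sum_sub_distrib, hA.symm i j]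
      congr 1
      exact Finset.sum_congr rfl fun a _ => by rw [hA.pow_symm 2 i a]; ring
  have h₃ : (A * Matrix.diagonal (A ^ 3).diag * A) i j = ∑ a, A i a * (A ^ 3) a a * A a j := by
    rw [Matrix.mul_apply]
    simp only [Matrix.mul_diagonal, Matrix.diag_apply]
  have h₄ : (A * (A ⊙ (A ^ 2))) i j = ∑ a, A i a * A a j * (A ^ 2) a j := by
    simp only [Matrix.mul_apply, Matrix.hadamard_apply, mul_assoc]
  have h₅ : ((A ⊙ (A ^ 2)) * A) i j = ∑ a, A i a * A a j * (A ^ 2) i a := by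
    rw [Matrix.mul_apply]
    simp only [Matrix.hadamard_apply, mul_right_comm]
  simp only [pathX5, Matrix.hadamard_one, hD, Matrix.sub_apply, Matrix.add_apply,
    Matrix.smul_apply, Matrix.mul_diagonal, Matrix.diagonal_mul, Matrix.diagonal_mul_diagonal,
    Matrix.hadamard_apply, h₁, h₂, h₃, h₄, h₅, hp, Matrix.diag_apply, hA.rowSum_mul_pathX3,
    pathX3_apply i j, offDiagOnes_of_ne hij, pathX2_apply i j, smul_eq_mul, mul_one]
  linear_combination (3 - 3 * (A ^ 2) j j - 3 * (A ^ 2) i i) * hA.idem i j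

/-- Every summand is masked by J, is an entrywise multiple of A, or is a zero-diagonal matrix
multiplied by diagonal ones. -/
lemma IsAdj.pathX_diag (hA : IsAdj A) (i : V) :
    pathX2 A i i = 0 ∧ pathX3 A i i = 0 ∧ pathX4 A i i = 0 ∧ pathX5 A i i = 0 := by
  have hJ := offDiagOnes_self i
  have hD : Matrix.diagonal (A ^ 2).diag - (1 : Matrix V V ℝ) =
      Matrix.diagonal (fun x => (A ^ 2) x x - 1) := by
    rw [← Matrix.diagonal_one, Matrix.diagonal_sub]; rfl
  have h2 : pathX2 A i i = 0 := by rw [pathX2_apply, hJ, mul_zero]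
  have h3 : pathX3 A i i = 0 := by simp [pathX3_apply, hJ, hA.diag]
  refine ⟨h2, h3, ?_, ?_⟩
  · simp [pathX4, Matrix.hadamard_one, hJ, h2, hA.diag]
  · simp only [pathX5, Matrix.hadamard_one, hD, hJ, h2, h3, hA.diag, Matrix.mul_diagonal,
      Matrix.diagonal_mul, Matrix.diagonal_mul_diagonal, Matrix.sub_apply, Matrix.add_apply,
      Matrix.smul_apply, Matrix.hadamard_apply, mul_zero, zero_mul, sub_zero, add_zero, smul_zero]

end Entries

/-! ### Sums of `middleCount` over the two middle nodes -/

section Sums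

variable {V : Type*} [Fintype V] [DecidableEq V] {A : Matrix V V ℝ}

/-- The contribution to the count of paths `i, a, b, c, d, j` of the two middle nodes `b` and `c`,
which are not `i` or `j`. -/
noncomputable def middleCount (A : Matrix V V ℝ) (i j b c : V) : ℝ :=
  A b c * (((A ^ 2) i b - A i c * A c b - A i j * A j b) *
    ((A ^ 2) c j - A c i * A i j - A c b * A b j) - ∑ a, A i a * A a b * (A c a * A a j))

variable {i j : V}

lemma IsAdj.sum_sum_middleCount (hA : IsAdj A) (i j : V) :
    ∑ b, ∑ c, middleCount A i j b c =
      (A ^ 5) i j - A i j * (A ^ 4) i i - A i j * (A ^ 4) j j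
        - ∑ a, (A ^ 2) i a * (A ^ 2) a a * A a j - ∑ a, A i a * (A ^ 2) a a * (A ^ 2) a j
        + A i j * ∑ a, A i a * (A ^ 2) a a + A i j * ∑ a, A j a * (A ^ 2) a a
        + (1 + A i j) * (A ^ 3) i j - ∑ a, A i a * (A ^ 3) a a * A a j := by
  have h₁ : ∑ b, ∑ c, (A ^ 2) i b * A b c * (A ^ 2) c j = (A ^ 5) i j := by
    simp only [pow_five_apply, pow_three_apply, Finset.mul_sum, mul_assoc]
  have h₂ : ∑ b, ∑ c, (A ^ 2) i b * A b c * A c i = (A ^ 4) i i := by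
    simp only [pow_four_apply', mul_assoc, ← Finset.mul_sum, ← pow_two_apply]
  have h₃ : ∑ b, ∑ c, (A ^ 2) i b * A b c * A b j = ∑ a, (A ^ 2) i a * (A ^ 2) a a * A a j := by
    simp only [hA.pow_two_diag, Finset.mul_sum, Finset.sum_mul]
  have h₄ : ∑ b, ∑ c, A i c * A b c * (A ^ 2) c j = ∑ a, A i a * (A ^ 2) a a * (A ^ 2) a j := by
    rw [Finset.sum_comm]
    simp only [hA.pow_two_diag, Finset.mul_sum, Finset.sum_mul, fun b c => hA.symm c b]
  have h₅ : ∑ b, ∑ c, A i c * A b c = ∑ a, A i a * (A ^ 2) a a := by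
    rw [Finset.sum_comm]
    simp only [hA.pow_two_diag, Finset.mul_sum, fun b c => hA.symm c b]
  have h₆ : ∑ b, ∑ c, A i c * A b c * A b j = (A ^ 3) i j := by
    simp only [pow_three_apply', pow_two_apply, Finset.sum_mul, fun b c => hA.symm c b]
  have h₇ : ∑ b, ∑ c, A j b * A b c * (A ^ 2) c j = (A ^ 4) j j := by
    simp only [pow_four_apply, pow_three_apply, Finset.mul_sum, mul_assoc]
  have h₈ : ∑ b, A j b * ∑ c, A b c = ∑ a, A j a * (A ^ 2) a a := by
    simp only [hA.pow_two_diag]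
  have h₉ : ∑ b, ∑ c, A b c * ∑ a, A i a * A a b * (A c a * A a j) =
      ∑ a, A i a * (A ^ 3) a a * A a j := by
    simp only [pow_three_apply, pow_two_apply, Finset.mul_sum, Finset.sum_mul]
    rw [Finset.sum_comm_cycle]
    exact Finset.sum_congr rfl fun a _ => Finset.sum_congr rfl fun b _ => Finset.sum_congr rfl fun c _ => by ring
  have key : ∀ b c, middleCount A i j b c = (A ^ 2) i b * A b c * (A ^ 2) c j
      - A i j * ((A ^ 2) i b * A b c * A c i) - (A ^ 2) i b * A b c * A b j
      - A i c * A b c * (A ^ 2) c j + A i j * (A i c * A b c) + A i c * A b c * A b j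
      - A i j * (A j b * A b c * (A ^ 2) c j) + A i j * (A i c * A b c * A b j)
      + A i j * (A j b * A b c)
      - A b c * ∑ a, A i a * A a b * (A c a * A a j) := fun b c => by
    rw [middleCount, hA.symm c b, hA.symm c i, hA.symm j b]
    -- The coefficients are the quotients in the reduction modulo x² = x for the adjacency entries.
    linear_combination (A i j * A i c ^ 2 + (A b c + 1) * A i c * A b j + A i j * A b j ^ 2
      - A b j * (A ^ 2) i b - A i c * (A ^ 2) c j) * hA.idem b c
      + A i j * A b c * hA.idem i c + A b c * A i c * A b j * hA.idem i j
      + A i j * A b c * hA.idem b j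
  simp only [key, Finset.sum_add_distrib, Finset.sum_sub_distrib, ← Finset.mul_sum,
    h₁, h₂, h₃, h₄, h₅, h₆, h₇, h₈]
  simp only [Finset.mul_sum] at h₉ ⊢
  rw [h₉]
  ring

/-- When b = i, the factor A i c sets the other occurrences of A i c to 1, so the factor counting a
no longer depends on c and leaves the sum. -/
lemma IsAdj.sum_middleCount_left (hA : IsAdj A) (i j : V) :
    ∑ c, middleCount A i j i c =
      ((A ^ 2) i i - 1 - A i j) * ((A ^ 3) i j - 2 * A i j * (A ^ 2) i i)
        - ∑ a, A i a * A a j * (A ^ 2) i a := by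
  have h₁ : ∑ c, A i c * ∑ a, A i a * A a i * (A c a * A a j) =
      ∑ a, A i a * A a j * (A ^ 2) i a := by
    simp only [pow_two_apply, Finset.mul_sum]
    rw [Finset.sum_comm]
    refine Finset.sum_congr rfl fun a _ => Finset.sum_congr rfl fun c _ => ?_
    rw [hA.symm a i]
    linear_combination A i c * A c a * A a j * hA.idem i a
  have key : ∀ c, middleCount A i j i c =
      ((A ^ 2) i i - 1 - A i j) * (A i c * (A ^ 2) c j - 2 * A i j * A i c)
        - A i c * ∑ a, A i a * A a i * (A c a * A a j) := fun c => by
    rw [middleCount, hA.symm c i, hA.symm j i]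
    linear_combination (2 * A i j * (A i c ^ 2 + A i c + 1) + 2 * A i j ^ 3
      - (A i c + 1) * (A ^ 2) c j - 2 * A i j * (A ^ 2) i i) * hA.idem i c
      + (2 * A i j * A i c - A i c * (A ^ 2) c j) * hA.idem i j
  simp only [key, Finset.sum_sub_distrib, ← Finset.mul_sum, h₁, ← pow_three_apply,
    ← hA.pow_two_diag]

/-- Reversing the path i, a, b, c, d, j. It turns the sums over c into the sums over b. -/
lemma IsAdj.middleCount_swap (hA : IsAdj A) (i j b c : V) :
    middleCount A i j b c = middleCount A j i c b := by
  have h : ∑ a, A i a * A a b * (A c a * A a j) = ∑ a, A j a * A a c * (A b a * A a i) :=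
    Finset.sum_congr rfl fun a _ => by
      rw [hA.symm i a, hA.symm a b, hA.symm c a, hA.symm a j]; ring
  rw [middleCount, middleCount, h, hA.pow_symm 2 i b, hA.pow_symm 2 c j, hA.symm c b, hA.symm c i,
    hA.symm j i, hA.symm j b]
  ring

lemma IsAdj.sum_middleCount_right (hA : IsAdj A) (i j : V) :
    ∑ b, middleCount A i j b j =
      ((A ^ 2) j j - 1 - A i j) * ((A ^ 3) i j - 2 * A i j * (A ^ 2) j j)
        - ∑ a, A i a * A a j * (A ^ 2) a j := by
  simp only [hA.middleCount_swap i j, hA.sum_middleCount_left, hA.pow_symm 3 j i, hA.symm j i]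
  congr 1
  exact Finset.sum_congr rfl fun a _ => by rw [hA.symm j a, hA.symm a i, hA.pow_symm 2 j a]; ring

/-- The factor 2 collects one copy from expanding the product and one from the coincidence a = d.
Together with the single copy in `IsAdj.sum_middleCount_right` it explains the coefficient 3 of A(A
⊙ A²) in X₅. -/
lemma IsAdj.sum_middleCount_cross_left (hA : IsAdj A) (i j : V) :
    ∑ c, middleCount A i j j c =
      (A ^ 2) i j * (A ^ 3) j j - A i j * (A ^ 2) i j * (A ^ 2) i j + A i j * (A ^ 2) i j
        - 2 * ∑ a, A i a * A a j * (A ^ 2) a j := by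
  have h₁ : ∑ c, A j c * ∑ a, A i a * A a j * (A c a * A a j) =
      ∑ a, A i a * A a j * (A ^ 2) a j := by
    simp only [pow_two_apply, Finset.mul_sum]
    rw [Finset.sum_comm]
    refine Finset.sum_congr rfl fun a _ => Finset.sum_congr rfl fun c _ => ?_
    rw [hA.symm j c, hA.symm c a]
    linear_combination A i a * A c j * A a c * hA.idem a j
  have h₂ : ∑ c, A i c * A j c = (A ^ 2) i j := by
    simp only [pow_two_apply, fun c => hA.symm j c]
  have h₃ : ∑ c, A j c * (A ^ 2) c j = (A ^ 3) j j := (pow_three_apply j j).symm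
  have h₄ : ∑ c, A i c * A c j * (A ^ 2) c j = ∑ c, A i c * A j c * (A ^ 2) c j := by
    simp only [fun c => hA.symm j c]
  have key : ∀ c, middleCount A i j j c = (A ^ 2) i j * (A j c * (A ^ 2) c j)
      - A i j * (A ^ 2) i j * (A i c * A j c) - A i c * A j c * (A ^ 2) c j
      + A i j * (A i c * A j c) - A j c * ∑ a, A i a * A a j * (A c a * A a j) := fun c => by
    rw [middleCount, hA.symm c j, hA.symm c i, hA.diag j]
    linear_combination (A i j * A i c * A i c - A i c * (A ^ 2) c j) * hA.idem j c
      + A i j * A j c * hA.idem i c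
  simp only [key, Finset.sum_add_distrib, Finset.sum_sub_distrib, ← Finset.mul_sum, h₂, h₃, h₁, h₄]
  ring

lemma IsAdj.sum_middleCount_cross_right (hA : IsAdj A) (i j : V) :
    ∑ b, middleCount A i j b i =
      (A ^ 2) i j * (A ^ 3) i i - A i j * (A ^ 2) i j * (A ^ 2) i j + A i j * (A ^ 2) i j
        - 2 * ∑ a, A i a * A a j * (A ^ 2) i a := by
  simp only [hA.middleCount_swap i j, hA.sum_middleCount_cross_left, hA.pow_symm 2 j i,
    hA.symm j i]
  congr 2
  exact Finset.sum_congr rfl fun a _ => by rw [hA.symm j a, hA.symm a i, hA.pow_symm 2 a i]; ring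

lemma IsAdj.middleCount_self (hA : IsAdj A) (i j b : V) : middleCount A i j b b = 0 := by
  rw [middleCount, hA.diag b, zero_mul]

lemma IsAdj.middleCount_ends (hA : IsAdj A) (i j : V) : middleCount A i j i j =
    A i j * (((A ^ 2) i i - 2) * ((A ^ 2) j j - 2) - (A ^ 2) i j) := by
  have h : ∑ a, A i a * A a i * (A j a * A a j) = (A ^ 2) i j := by
    rw [pow_two_apply]
    refine Finset.sum_congr rfl fun a _ => ?_
    rw [hA.symm a i, hA.symm j a, hA.idem, hA.idem]
  rw [middleCount, h, hA.symm j i]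
  linear_combination (4 * (A i j ^ 3 + A i j ^ 2 + A i j + 1)
    - 2 * (A i j + 1) * ((A ^ 2) i i + (A ^ 2) j j)) * hA.idem i j

/-- For adjacent i and j this counts ordered pairs of distinct common neighbours. It supplies one
copy of the last term of X₅; the two cross sums supply the other two. -/
lemma IsAdj.middleCount_ends_swap (hA : IsAdj A) (i j : V) : middleCount A i j j i =
    A i j * ((A ^ 2) i j * (A ^ 2) i j - (A ^ 2) i j) := by
  have h : ∑ a, A i a * A a j * (A i a * A a j) = (A ^ 2) i j := by
    rw [pow_two_apply]
    exact Finset.sum_congr rfl fun a _ => by rw [mul_mul_mul_comm, hA.idem, hA.idem]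
  rw [middleCount, h, hA.symm j i, hA.diag, hA.diag]
  ring

/-- The entries of `pathX5` as a sum over the two middle nodes. -/
lemma IsAdj.pathX5_eq_sum (hA : IsAdj A) {i j : V} (hij : i ≠ j) : pathX5 A i j =
    ∑ b, ∑ c, middleCount A i j b c * offDiagOnes V c i * offDiagOnes V c j *
      (offDiagOnes V b i * offDiagOnes V b j) := by
  rw [sum_sum_masked _ hij, hA.pathX5_apply_of_ne hij, hA.sum_sum_middleCount,
    hA.sum_middleCount_left, hA.sum_middleCount_right, hA.sum_middleCount_cross_left,
    hA.sum_middleCount_cross_right, hA.middleCount_self, hA.middleCount_self, hA.middleCount_ends,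
    hA.middleCount_ends_swap]
  linear_combination 2 * ((A ^ 2) i i + (A ^ 2) j j) * hA.idem i j

end Sums

/-! ### Matching the entries with the path counts -/

section Counts

lemma SimpleGraph.isAdj_adjMatrix {V : Type*} (G : SimpleGraph V)
    [DecidableRel G.Adj] :
    IsAdj (G.adjMatrix ℝ) where
  symm x y := by simp [SimpleGraph.adjMatrix_apply, G.adj_comm]
  diag x := by simp
  idem x y := by simp [SimpleGraph.adjMatrix_apply]

variable {V : Type*} [Fintype V] [DecidableEq V] {A : Matrix V V ℝ} {i j : V}

lemma IsAdj.pathX3_eq_sum (hA : IsAdj A) (hij : i ≠ j) : pathX3 A i j =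
    ∑ b, A b j * (∑ a, A i a * A a b * offDiagOnes V a j) * offDiagOnes V b i := by
  rw [sum_mul_offDiagOnes (fun b => A b j * (∑ a, A i a * A a b * offDiagOnes V a j)), pathX3_apply,
    offDiagOnes_of_ne hij]
  simp only [sum_mul_offDiagOnes (fun a => A i a * A a _), ← pow_two_apply]
  have h : ∑ b, A b j * ((A ^ 2) i b - A i j * A j b) = (A ^ 3) i j - A i j * (A ^ 2) j j := by
    rw [pow_three_apply', pow_two_apply j j, Finset.mul_sum, ← Finset.sum_sub_distrib]
    exact Finset.sum_congr rfl fun b _ => by ring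
  rw [h, hA.symm j i]
  linear_combination -(1 + A i j) * hA.idem i j

lemma IsAdj.pathX4_eq_sum (hA : IsAdj A) (hij : i ≠ j) : pathX4 A i j =
    ∑ b, (∑ a, ∑ c, (A i a * A a b * offDiagOnes V a j) *
      (A b c * A c j * offDiagOnes V c i) * offDiagOnes V c a) *
      offDiagOnes V b i * offDiagOnes V b j := by
  -- With the middle node b fixed, a and c are independent except for a ≠ c; in the coincidence sum
  -- the remaining masks are absorbed by adjacency.
  have key : ∀ b, ∑ a, ∑ c, (A i a * A a b * offDiagOnes V a j) *
      (A b c * A c j * offDiagOnes V c i) * offDiagOnes V c a =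
      ((A ^ 2) i b - A i j * A j b) * ((A ^ 2) b j - A b i * A i j)
        - ∑ a, A i a * A b a * A a j := fun b => by
    rw [sum_sum_mul_offDiagOnes (fun a => A i a * A a b * offDiagOnes V a j)
      (fun c => A b c * A c j * offDiagOnes V c i), sum_mul_offDiagOnes (fun a => A i a * A a b),
      sum_mul_offDiagOnes (fun c => A b c * A c j), ← pow_two_apply, ← pow_two_apply]
    congr 1
    refine Finset.sum_congr rfl fun a _ => ?_
    have h₁ := hA.mul_offDiagOnes a j
    have h₂ : A i a * offDiagOnes V a i = A i a := by rw [hA.symm i a, hA.mul_offDiagOnes]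
    rw [hA.symm a b]
    linear_combination (A i a * offDiagOnes V a i) * A b a * A b a * h₁ +
      A b a * A b a * A a j * h₂ + A i a * A a j * hA.idem b a
  simp only [key]
  rw [sum_mul_offDiagOnes_mul_offDiagOnes _ hij, hA.diag i, hA.diag j, pathX4_apply_of_ne hij,
    Finset.sum_sub_distrib]
  have h₁ : ∑ b, ((A ^ 2) i b - A i j * A j b) * ((A ^ 2) b j - A b i * A i j) =
      (A ^ 4) i j - A i j * (A ^ 3) i i - A i j * (A ^ 3) j j + A i j * A i j * (A ^ 2) i j := by
    rw [pow_four_apply', pow_three_apply' i i, pow_three_apply j j, hA.pow_symm 2 i j,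
      pow_two_apply j i, Finset.mul_sum, Finset.mul_sum, Finset.mul_sum,
      ← Finset.sum_sub_distrib, ← Finset.sum_sub_distrib, ← Finset.sum_add_distrib]
    exact Finset.sum_congr rfl fun b _ => by ring
  have h₂ : ∑ b, ∑ a, A i a * A b a * A a j = ∑ a, A i a * (A ^ 2) a a * A a j := by
    rw [Finset.sum_comm]
    simp only [hA.pow_two_diag, Finset.mul_sum, Finset.sum_mul, fun b a => hA.symm b a]
  -- The coincidence sum at the excluded values b = i and b = j gives A² i j twice: this is the 2I
  -- in X₄.
  have h₃ : ∑ a, A i a * A i a * A a j = (A ^ 2) i j := by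
    simp only [hA.idem, pow_two_apply]
  have h₄ : ∑ a, A i a * A j a * A a j = (A ^ 2) i j := by
    rw [pow_two_apply]
    exact Finset.sum_congr rfl fun a _ => by rw [hA.symm j a, mul_assoc, hA.idem]
  rw [h₁, h₂, h₃, h₄, hA.symm j i]
  linear_combination -(3 * (A ^ 2) i j) * hA.idem i j

/-- The node a avoids c and j, and d avoids i and b. The hypotheses make each pair of forbidden
values distinct, so the two corrections subtract separately. When a = d, all four masks follow from
adjacency. -/
lemma IsAdj.middleCount_eq_sum (hA : IsAdj A) {b c : V} (hc : c ≠ j) (hb : b ≠ i) :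
    A b c * (∑ a, ∑ d, (A i a * A a b * offDiagOnes V a c * offDiagOnes V a j) *
        (A c d * A d j * offDiagOnes V d i * offDiagOnes V d b) * offDiagOnes V d a) =
      middleCount A i j b c := by
  rw [sum_sum_mul_offDiagOnes (fun a => A i a * A a b * offDiagOnes V a c * offDiagOnes V a j)
    (fun d => A c d * A d j * offDiagOnes V d i * offDiagOnes V d b),
    sum_mul_offDiagOnes_mul_offDiagOnes (fun a => A i a * A a b) hc,
    sum_mul_offDiagOnes_mul_offDiagOnes (fun d => A c d * A d j) hb.symm, ← pow_two_apply,
    ← pow_two_apply, middleCount]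
  congr 2
  refine Finset.sum_congr rfl fun a _ => ?_
  have h₁ : A i a * offDiagOnes V a i = A i a := by rw [hA.symm i a, hA.mul_offDiagOnes]
  have h₂ : A c a * offDiagOnes V a c = A c a := by rw [hA.symm c a, hA.mul_offDiagOnes]
  calc _ = (A i a * offDiagOnes V a i) * (A a b * offDiagOnes V a b) *
        ((A c a * offDiagOnes V a c) * (A a j * offDiagOnes V a j)) := by ring
    _ = _ := by rw [h₁, h₂, hA.mul_offDiagOnes, hA.mul_offDiagOnes]

variable (G : SimpleGraph V) [DecidableRel G.Adj] (i j : V)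

lemma pathX2_eq_numPaths : pathX2 (G.adjMatrix ℝ) i j = numPaths G 2 i j := by
  rcases eq_or_ne i j with rfl | hij
  · rw [(G.isAdj_adjMatrix.pathX_diag i).1, numPaths_self, Nat.cast_zero]
  · rw [numPaths_two G hij, pathX2_apply, offDiagOnes_of_ne hij, mul_one, pow_two_apply]

lemma pathX3_eq_numPaths : pathX3 (G.adjMatrix ℝ) i j = numPaths G 3 i j := by
  rcases eq_or_ne i j with rfl | hij
  · rw [(G.isAdj_adjMatrix.pathX_diag i).2.1, numPaths_self, Nat.cast_zero]
  · rw [numPaths_three G hij, G.isAdj_adjMatrix.pathX3_eq_sum hij]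

lemma pathX4_eq_numPaths : pathX4 (G.adjMatrix ℝ) i j = numPaths G 4 i j := by
  rcases eq_or_ne i j with rfl | hij
  · rw [(G.isAdj_adjMatrix.pathX_diag i).2.2.1, numPaths_self, Nat.cast_zero]
  · rw [numPaths_four G hij, G.isAdj_adjMatrix.pathX4_eq_sum hij]

lemma pathX5_eq_numPaths : pathX5 (G.adjMatrix ℝ) i j = numPaths G 5 i j := by
  rcases eq_or_ne i j with rfl | hij
  · rw [(G.isAdj_adjMatrix.pathX_diag i).2.2.2, numPaths_self, Nat.cast_zero]
  · rw [numPaths_five G hij, G.isAdj_adjMatrix.pathX5_eq_sum hij]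
    refine Finset.sum_congr rfl fun b _ => Finset.sum_congr rfl fun c _ => ?_
    -- If c = j or b = i the closed form is not available, but the outer mask is zero.
    rcases eq_or_ne c j with rfl | hc
    · simp [offDiagOnes_self]
    rcases eq_or_ne b i with rfl | hb
    · simp [offDiagOnes_self]
    rw [G.isAdj_adjMatrix.middleCount_eq_sum hc hb]

end Counts

theorem mainTheorem4 :
    ∃ e₂ e₃ e₄ e₅ : MatLang .node .node,
      (e₂ ∈ MatLang.ML3 ∧ e₃ ∈ MatLang.ML3 ∧ e₄ ∈ MatLang.ML3 ∧ e₅ ∈ MatLang.ML3) ∧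
      ∀ (V : Type*) [Fintype V] [DecidableEq V] (G : SimpleGraph V) [DecidableRel G.Adj],
        (e₂.eval (G.adjMatrix ℝ) = pathX2 (G.adjMatrix ℝ) ∧
          e₃.eval (G.adjMatrix ℝ) = pathX3 (G.adjMatrix ℝ) ∧
          e₄.eval (G.adjMatrix ℝ) = pathX4 (G.adjMatrix ℝ) ∧
          e₅.eval (G.adjMatrix ℝ) = pathX5 (G.adjMatrix ℝ)) ∧
        ∀ i j : V,
          pathX2 (G.adjMatrix ℝ) i j = (numPaths G 2 i j : ℝ) ∧
          pathX3 (G.adjMatrix ℝ) i j = (numPaths G 3 i j : ℝ) ∧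
          pathX4 (G.adjMatrix ℝ) i j = (numPaths G 4 i j : ℝ) ∧
          pathX5 (G.adjMatrix ℝ) i j = (numPaths G 5 i j : ℝ) := by
  refine ⟨MatLang.exprX2, MatLang.exprX3, MatLang.exprX4, MatLang.exprX5,
    ⟨MatLang.exprX2_mem, MatLang.exprX3_mem, MatLang.exprX4_mem, MatLang.exprX5_mem⟩, ?_⟩
  intro V _ _ G _
  exact ⟨⟨MatLang.value_exprX2 _, MatLang.value_exprX3 _, MatLang.value_exprX4 _,
    MatLang.value_exprX5 _⟩, fun i j => ⟨pathX2_eq_numPaths G i j, pathX3_eq_numPaths G i j,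
    pathX4_eq_numPaths G i j, pathX5_eq_numPaths G i j⟩⟩
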